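/- Let $d\ge 2$ and let $\Omega\subset\mathbb{R}^d$ be a bounded, connected, open set of class $C^2$. Let $p>d$. Then there is a constant $C$, depending only on $\Omega$ and $p$, such that the following holds. Let $b:\overline\Omega\to\mathbb{R}^d$ be Lipschitz continuous, and let $\sigma\in H^1(\Omega)$ be an invariant measure for $b$, i.e. * (C1) $-\operatorname{div}(\nabla\sigma+\sigma b)=0$ in $\Omega$, in the sense of distributions; * (C2) $\inf_\Omega\sigma>0$ (essential infimum); * (C3) there is a constant $C_\sigma$ such that, for all $v\in H^1_0(\Omega)$, $\sigma v\in H^1_0(\Omega)$ and $\|\sigma v\|_{H^1(\Omega)}\le C_\sigma\|v\|_{H^1(\Omega)}$. Let $f\in H^{-1}(\Omega)$, and let $u\in H^1_0(\Omega)$ be the weak solution of $$-\operatorname{div}(\sigma\nabla u)+(\nabla\sigma+\sigma b)\cdot\nabla u=\sigma f\ \text{ in }\Omega,\qquad u=0\ \text{ on }\partial\Omega,$$ that is, $\int_\Omega \sigma\nabla u\cdot\nabla v+\big((\nabla\sigma+\sigma b)\cdot\nabla u\big)\,v=\langle f,\sigma v\rangle$ for all $v\in H^1_0(\Omega)$.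 Let $U_H$ be a linear subspace of $H^1_0(\Omega)$ and let $u_H\in U_H$ be the solution of the discrete problem $$a_{\rm ss}(\sigma;u_H,v_H)=\langle f,\sigma v_H\rangle\qquad\text{for all } v_H\in U_H,$$ where $$a_{\rm ss}(\sigma;w,v)=\int_\Omega \sigma\nabla w\cdot\nabla v+(\nabla\sigma+\sigma b)\cdot\frac{(\nabla w)\,v-(\nabla v)\,w}{2}.$$ Then $$\|u-u_H\|_{H^1(\Omega)}\le C\,\left[\frac{\|\sigma\|_{L^\infty(\Omega)}+\|\nabla\sigma+\sigma b\|_{L^p(\Omega)}}{\inf_\Omega\sigma}\right]\inf_{v_H\in U_H}\|u-v_H\|_{H^1(\Omega)},$$ in $[0,\infty]$, with the convention $\infty\cdot 0=0$ on the right-hand side. -/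

import Mathlib

open MeasureTheory Set Filter Topology
open scoped ENNReal NNReal ContDiff RealInnerProductSpace

noncomputable section

namespace AdvDiff

/-- `φ ∈ C_c^∞(Ω)`: smooth with compact support contained in `Ω`. -/
structure IsTest {d : ℕ} (Ω : Set (EuclideanSpace ℝ (Fin d)))
    (φ : EuclideanSpace ℝ (Fin d) → ℝ) : Prop where
  smooth : ContDiff ℝ ∞ φ
  compact : HasCompactSupport φ
  supp : tsupport φ ⊆ Ω

/-- `Ω` is of class `C²`: near each boundary point, `Ω` is the strict sublevel set of a `C²`
function with nonvanishing gradient. (By the implicit function theorem, this says that, up to a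
rotation, `Ω` locally lies on one side of the graph of a `C²` function.) -/
def IsC2Domain {d : ℕ} (Ω : Set (EuclideanSpace ℝ (Fin d))) : Prop :=
  ∀ x ∈ frontier Ω, ∃ U : Set (EuclideanSpace ℝ (Fin d)), IsOpen U ∧ x ∈ U ∧
    ∃ ρ : EuclideanSpace ℝ (Fin d) → ℝ, ContDiffOn ℝ 2 ρ U ∧ fderiv ℝ ρ x ≠ 0 ∧
      Ω ∩ U = {y ∈ U | ρ y < 0} ∧ frontier Ω ∩ U = {y ∈ U | ρ y = 0}

/-- `g` is the weak gradient of `u` in `Ω`: `∫_Ω u ∇φ = - ∫_Ω φ g` for all `φ ∈ C_c^∞(Ω)`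
(an identity between vectors). It is only used for square integrable `u` and `g`, for which both
integrals converge. -/
def HasWeakGradient {d : ℕ} (Ω : Set (EuclideanSpace ℝ (Fin d)))
    (u : EuclideanSpace ℝ (Fin d) → ℝ)
    (g : EuclideanSpace ℝ (Fin d) → EuclideanSpace ℝ (Fin d)) : Prop :=
  ∀ φ, IsTest Ω φ → ∫ x in Ω, u x • gradient φ x = - ∫ x in Ω, φ x • g x

theorem IsTest.integrable_smul_gradient {d : ℕ} {Ω : Set (EuclideanSpace ℝ (Fin d))}
    {φ : EuclideanSpace ℝ (Fin d) → ℝ} (hφ : IsTest Ω φ)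
    (u : Lp ℝ 2 (volume.restrict Ω)) :
    Integrable (fun x => u x • gradient φ x) (volume.restrict Ω) := by
  have hc : Continuous (gradient φ) :=
    (LinearIsometryEquiv.continuous _).comp (hφ.smooth.continuous_fderiv (by simp))
  have hs : HasCompactSupport (gradient φ) := by
    have h := hφ.compact.fderiv (𝕜 := ℝ)
    exact h.comp_left (g := (InnerProductSpace.toDual ℝ (EuclideanSpace ℝ (Fin d))).symm)
      (map_zero _)
  have hm : MemLp (gradient φ) 2 (volume.restrict Ω) :=
    (hc.memLp_of_hasCompactSupport hs).restrict Ω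
  exact memLp_one_iff_integrable.1 (hm.smul (Lp.memLp u))

theorem IsTest.integrable_smul {d : ℕ} {Ω : Set (EuclideanSpace ℝ (Fin d))}
    {φ : EuclideanSpace ℝ (Fin d) → ℝ} (hφ : IsTest Ω φ)
    (g : Lp (EuclideanSpace ℝ (Fin d)) 2 (volume.restrict Ω)) :
    Integrable (fun x => φ x • g x) (volume.restrict Ω) := by
  have hm : MemLp φ 2 (volume.restrict Ω) :=
    (hφ.smooth.continuous.memLp_of_hasCompactSupport hφ.compact).restrict Ω
  exact memLp_one_iff_integrable.1 ((Lp.memLp g).smul hm)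

/-- The Sobolev space `H¹(Ω)`, as the space of pairs `(u, ∇u)` in `L²(Ω) × L²(Ω)^d`. It inherits
the norm `‖u‖_{H¹} = (‖u‖_{L²}² + ‖∇u‖_{L²}²)^{1/2}`. -/
def H1 {d : ℕ} (Ω : Set (EuclideanSpace ℝ (Fin d))) :
    Submodule ℝ (WithLp 2 (Lp ℝ 2 (volume.restrict Ω) ×
      Lp (EuclideanSpace ℝ (Fin d)) 2 (volume.restrict Ω))) where
  carrier := {w | HasWeakGradient Ω w.fst w.snd}
  add_mem' := by
    intro a b ha hb φ hφ
    have h1 : ∫ x in Ω, (a + b).fst x • gradient φ x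
        = ∫ x in Ω, (a.fst x • gradient φ x + b.fst x • gradient φ x) := by
      refine integral_congr_ae ?_
      filter_upwards [Lp.coeFn_add a.fst b.fst] with x hx
      simp only [WithLp.add_fst, hx, Pi.add_apply, add_smul]
    have h2 : ∫ x in Ω, φ x • (a + b).snd x
        = ∫ x in Ω, (φ x • a.snd x + φ x • b.snd x) := by
      refine integral_congr_ae ?_
      filter_upwards [Lp.coeFn_add a.snd b.snd] with x hx
      simp only [WithLp.add_snd, hx, Pi.add_apply, smul_add]
    rw [h1, h2, integral_add (hφ.integrable_smul_gradient _) (hφ.integrable_smul_gradient _),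
      integral_add (hφ.integrable_smul _) (hφ.integrable_smul _), ha φ hφ, hb φ hφ, neg_add]
  zero_mem' := by
    intro φ hφ
    have h1 : ∫ x in Ω, (0 : Lp ℝ 2 (volume.restrict Ω)) x • gradient φ x = 0 := by
      refine integral_eq_zero_of_ae ?_
      filter_upwards [Lp.coeFn_zero ℝ 2 (volume.restrict Ω)] with x hx
      rw [hx, Pi.zero_apply, zero_smul]
      rfl
    have h2 : ∫ x in Ω, φ x •
        (0 : Lp (EuclideanSpace ℝ (Fin d)) 2 (volume.restrict Ω)) x = 0 := by
      refine integral_eq_zero_of_ae ?_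
      filter_upwards [Lp.coeFn_zero (EuclideanSpace ℝ (Fin d)) 2 (volume.restrict Ω)] with x hx
      rw [hx, Pi.zero_apply, smul_zero]
    simp only [WithLp.zero_fst, WithLp.zero_snd, h1, h2, neg_zero]
  smul_mem' := by
    intro c a ha φ hφ
    have h1 : ∫ x in Ω, (c • a).fst x • gradient φ x
        = ∫ x in Ω, c • (a.fst x • gradient φ x) := by
      refine integral_congr_ae ?_
      filter_upwards [Lp.coeFn_smul c a.fst] with x hx
      simp only [WithLp.smul_fst, hx, Pi.smul_apply, smul_smul, smul_eq_mul]
    have h2 : ∫ x in Ω, φ x • (c • a).snd x = ∫ x in Ω, c • (φ x • a.snd x) := by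
      refine integral_congr_ae ?_
      filter_upwards [Lp.coeFn_smul c a.snd] with x hx
      simp only [WithLp.smul_snd, hx, Pi.smul_apply, smul_smul, mul_comm]
    rw [h1, h2, integral_smul, integral_smul, ha φ hφ, smul_neg]

section Problem

variable {d : ℕ} {Ω : Set (EuclideanSpace ℝ (Fin d))}

/-- The function underlying an element of `H¹(Ω)` (defined almost everywhere in `Ω`). -/
def fn (w : H1 Ω) : EuclideanSpace ℝ (Fin d) → ℝ := w.1.fst

/-- The weak gradient of an element of `H¹(Ω)` (defined almost everywhere in `Ω`). -/
def wgrad (w : H1 Ω) : EuclideanSpace ℝ (Fin d) → EuclideanSpace ℝ (Fin d) := w.1.snd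

/-- `H¹₀(Ω)`: the closure in `H¹(Ω)` of the subspace of (classes of) functions of `C_c^∞(Ω)`. -/
def H10 (Ω : Set (EuclideanSpace ℝ (Fin d))) : Submodule ℝ (H1 Ω) :=
  (Submodule.span ℝ
    {w : H1 Ω | ∃ φ, IsTest Ω φ ∧ fn w =ᵐ[volume.restrict Ω] φ}).topologicalClosure

/-- The dual space `H⁻¹(Ω)` of `H¹₀(Ω)`. -/
abbrev HNeg1 (Ω : Set (EuclideanSpace ℝ (Fin d))) : Type := H10 Ω →L[ℝ] ℝ

/-- `w ∈ H¹₀(Ω)` is the product `σ v`. -/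
def IsProd (σ : H1 Ω) (v w : H10 Ω) : Prop :=
  fn w.1 =ᵐ[volume.restrict Ω] fun x => fn σ x * fn v.1 x

/-- The field `B = ∇σ + σ b`. -/
def field (b : EuclideanSpace ℝ (Fin d) → EuclideanSpace ℝ (Fin d)) (σ : H1 Ω) :
    EuclideanSpace ℝ (Fin d) → EuclideanSpace ℝ (Fin d) :=
  fun x => wgrad σ x + fn σ x • b x

/-- `inf_Ω σ`, the essential infimum of `σ` in `Ω`. -/
def infOn (σ : H1 Ω) : ℝ := essInf (fn σ) (volume.restrict Ω)

/-- `σ` is an (exact) invariant measure for the advection field `b`. -/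
structure IsInvariantMeasure (b : EuclideanSpace ℝ (Fin d) → EuclideanSpace ℝ (Fin d))
    (σ : H1 Ω) : Prop where
  /-- `-div (∇σ + b σ) = 0` in `Ω`, in the sense of distributions. -/
  adjoint : ∀ φ, IsTest Ω φ → ∫ x in Ω, ⟪field b σ x, gradient φ x⟫ = 0
  /-- `inf_Ω σ > 0`. -/
  pos : 0 < infOn σ
  /-- For all `v ∈ H¹₀(Ω)`, `σ v ∈ H¹₀(Ω)` and `‖σ v‖_{H¹} ≤ Cσ ‖v‖_{H¹}`. -/
  mult : ∃ Cσ : ℝ, ∀ v : H10 Ω, ∃ w : H10 Ω, IsProd σ v w ∧ ‖w‖ ≤ Cσ * ‖v‖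

/-- `u ∈ H¹₀(Ω)` is a weak solution of `-div (σ ∇u) + (∇σ + σ b) · ∇u = σ f` in `Ω`, `u = 0` on
`∂Ω`: for all `v ∈ H¹₀(Ω)`,
`∫_Ω σ ∇u · ∇v + ((∇σ + σ b) · ∇u) v = ⟨f, σ v⟩_{H⁻¹, H¹₀}`. -/
def IsModifiedSolution (b : EuclideanSpace ℝ (Fin d) → EuclideanSpace ℝ (Fin d))
    (σ : H1 Ω) (f : HNeg1 Ω) (u : H10 Ω) : Prop :=
  ∀ v : H10 Ω, ∃ w : H10 Ω, IsProd σ v w ∧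
    ∫ x in Ω, (fn σ x * ⟪wgrad u.1 x, wgrad v.1 x⟫
      + ⟪field b σ x, wgrad u.1 x⟫ * fn v.1 x) = f w

/-- The form with skew-symmetric advection part
`a_ss(σ; u, v) = ∫_Ω σ ∇u · ∇v + B · ((∇u) v - (∇v) u) / 2`, with `B = ∇σ + σ b`. -/
def aSS (b : EuclideanSpace ℝ (Fin d) → EuclideanSpace ℝ (Fin d)) (σ : H1 Ω)
    (u v : H10 Ω) : ℝ :=
  ∫ x in Ω, (fn σ x * ⟪wgrad u.1 x, wgrad v.1 x⟫
    + ⟪field b σ x, fn v.1 x • wgrad u.1 x - fn u.1 x • wgrad v.1 x⟫ / 2)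

/-- `uH ∈ UH` is a solution of the discrete problem: `a_ss(σ; uH, v) = ⟨f, σ v⟩` for all
`v ∈ UH`. -/
def IsDiscreteSolution (b : EuclideanSpace ℝ (Fin d) → EuclideanSpace ℝ (Fin d))
    (σ : H1 Ω) (f : HNeg1 Ω) (UH : Submodule ℝ (H10 Ω)) (uH : H10 Ω) : Prop :=
  uH ∈ UH ∧ ∀ v ∈ UH, ∃ w : H10 Ω, IsProd σ v w ∧ aSS b σ uH v = f w

end Problem

end AdvDiff

end

/-! This is Céa's lemma for a form whose advection part is skew-symmetric. Write `B = ∇σ + σ b`.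
Since `div B = 0`, integrating `B · ∇(uv)` shows that the advection term of the continuous problem
equals its skew-symmetrized version (`inner_mulL_add_inner_mulL`). Hence `u` also solves the problem
posed with `a_ss`, and `u - u_H` is Galerkin orthogonal to `U_H`. The skew part vanishes on the
diagonal, so coercivity comes only from `σ ≥ inf σ` and the Poincaré inequality, whatever the size
of `B`. Continuity needs the operator `v ↦ v B` to be bounded from `H¹₀` to `L²`: for `p > d`,
Hölder and the subcritical Sobolev inequality bound its norm by `C ‖B‖_{L^p}`
(`exists_eLpNorm_fnL_smul_le`). The abstract estimate is `mul_norm_sub_le_of_galerkin`.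

Two points rest on the multiplier property (C3). It forces `σ ∈ L^∞` (`ae_nnnorm_le_of_multiplier`).
It also makes `v ↦ v B` bounded even when `‖B‖_{L^p} = ∞`
(`eLpNorm_fnL_smul_field_le_of_multiplier`), which is needed because the convention `∞ · 0 = 0` then
asserts that `u = u_H` as soon as `u` is in the closure of `U_H`. -/

noncomputable section

namespace AdvDiff

/-! ### Test functions, the Sobolev inequality and weak gradients. -/

section Sobolev

variable {d : ℕ} {Ω : Set (EuclideanSpace ℝ (Fin d))}

theorem IsTest.continuous_gradient {φ : EuclideanSpace ℝ (Fin d) → ℝ} (hφ : IsTest Ω φ) :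
    Continuous (gradient φ) :=
  (LinearIsometryEquiv.continuous _).comp (hφ.smooth.continuous_fderiv (by simp))

theorem IsTest.hasCompactSupport_gradient {φ : EuclideanSpace ℝ (Fin d) → ℝ}
    (hφ : IsTest Ω φ) : HasCompactSupport (gradient φ) :=
  (hφ.compact.fderiv (𝕜 := ℝ)).comp_left
    (g := (InnerProductSpace.toDual ℝ (EuclideanSpace ℝ (Fin d))).symm) (map_zero _)

theorem IsTest.memLp {φ : EuclideanSpace ℝ (Fin d) → ℝ} (hφ : IsTest Ω φ) (q : ℝ≥0∞) :
    MemLp φ q (volume.restrict Ω) :=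
  (hφ.smooth.continuous.memLp_of_hasCompactSupport hφ.compact).restrict Ω

theorem IsTest.memLp_gradient {φ : EuclideanSpace ℝ (Fin d) → ℝ} (hφ : IsTest Ω φ)
    (q : ℝ≥0∞) : MemLp (gradient φ) q (volume.restrict Ω) :=
  (hφ.continuous_gradient.memLp_of_hasCompactSupport hφ.hasCompactSupport_gradient).restrict Ω

theorem IsTest.differentiable {φ : EuclideanSpace ℝ (Fin d) → ℝ} (hφ : IsTest Ω φ) :
    Differentiable ℝ φ := hφ.smooth.differentiable (by simp)

theorem IsTest.add {φ ψ : EuclideanSpace ℝ (Fin d) → ℝ} (hφ : IsTest Ω φ) (hψ : IsTest Ω ψ) :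
    IsTest Ω (φ + ψ) where
  smooth := hφ.smooth.add hψ.smooth
  compact := hφ.compact.add hψ.compact
  supp := (tsupport_add φ ψ).trans (union_subset hφ.supp hψ.supp)

theorem IsTest.const_smul {φ : EuclideanSpace ℝ (Fin d) → ℝ} (hφ : IsTest Ω φ) (c : ℝ) :
    IsTest Ω (c • φ) where
  smooth := contDiff_const.smul hφ.smooth
  compact := hφ.compact.smul_left (f := fun _ => c)
  supp := (tsupport_smul_subset_right (fun _ => c) φ).trans hφ.supp

theorem IsTest.mul {φ ψ : EuclideanSpace ℝ (Fin d) → ℝ} (hφ : IsTest Ω φ) (hψ : IsTest Ω ψ) :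
    IsTest Ω (φ * ψ) where
  smooth := hφ.smooth.mul hψ.smooth
  compact := hφ.compact.mul_right
  supp := (tsupport_mul_subset_left).trans hφ.supp

theorem IsTest.zero : IsTest Ω (0 : EuclideanSpace ℝ (Fin d) → ℝ) where
  smooth := contDiff_const
  compact := HasCompactSupport.zero
  supp := by simp [tsupport]

theorem IsTest.gradient_mul {φ ψ : EuclideanSpace ℝ (Fin d) → ℝ} (hφ : IsTest Ω φ)
    (hψ : IsTest Ω ψ) (x : EuclideanSpace ℝ (Fin d)) :
    gradient (φ * ψ) x = φ x • gradient ψ x + ψ x • gradient φ x := by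
  rw [gradient, fderiv_mul (hφ.differentiable x) (hψ.differentiable x)]
  simp [gradient]

/-- Sobolev inequality for test functions on a bounded set, controlled by the `L²` norm of the
gradient. -/
theorem exists_eLpNorm_le_eLpNorm_gradient (hd : 2 ≤ d) (hΩb : Bornology.IsBounded Ω) (q : ℝ≥0)
    (hq : (1 / 2 : ℝ) - (d : ℝ)⁻¹ < (q : ℝ)⁻¹) :
    ∃ C : ℝ≥0, ∀ φ, IsTest Ω φ → eLpNorm φ q (volume.restrict Ω) ≤
      C * eLpNorm (gradient φ) 2 (volume.restrict Ω) := by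
  -- The exponent `r` whose Sobolev conjugate is `q`, raised to `1` if it falls below. The strict
  -- inequality on `q` gives `r < 2 ≤ d`, so the Sobolev inequality in `W^{1,r}` applies even for `d
  -- = 2`, where `r = 2` would be excluded.
  set r : ℝ≥0 := (min 1 (q⁻¹ + (d : ℝ≥0)⁻¹))⁻¹ with hr
  have hd0 : (0 : ℝ) < d := by positivity
  have hmin : (1 / 2 : ℝ≥0) < min 1 (q⁻¹ + (d : ℝ≥0)⁻¹) := by
    refine lt_min (by rw [← NNReal.coe_lt_coe]; norm_num) ?_
    rw [← NNReal.coe_lt_coe]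
    push_cast
    linarith
  have hmin0 : 0 < min 1 (q⁻¹ + (d : ℝ≥0)⁻¹) := lt_of_le_of_lt (by positivity) hmin
  have hr1 : 1 ≤ r := (one_le_inv₀ hmin0).2 (min_le_left _ _)
  have hr2 : r < 2 := by
    rw [hr]
    refine (inv_lt_comm₀ hmin0 (by norm_num)).2 (by simpa using hmin)
  have hrd : (r : ℝ≥0) < Module.finrank ℝ (EuclideanSpace ℝ (Fin d)) := by
    rw [finrank_euclideanSpace_fin]
    exact hr2.trans_le (by exact_mod_cast hd)
  have hrq : (r : ℝ)⁻¹ - (Module.finrank ℝ (EuclideanSpace ℝ (Fin d)) : ℝ)⁻¹ ≤ (q : ℝ)⁻¹ := by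
    rw [finrank_euclideanSpace_fin, hr]
    have : min 1 (q⁻¹ + (d : ℝ≥0)⁻¹) ≤ q⁻¹ + (d : ℝ≥0)⁻¹ := min_le_right _ _
    have := NNReal.coe_le_coe.2 this
    push_cast at this ⊢
    rw [inv_inv]
    linarith
  have hfin : volume Ω < ⊤ := hΩb.measure_lt_top
  -- The Hölder factor `|Ω|^{1/r - 1/2}` for passing from `L^r` to `L²`; it is finite because `Ω` is
  -- bounded.
  set m : ℝ≥0∞ := (volume.restrict Ω) univ ^ (1 / (r : ℝ≥0∞).toReal - 1 / (2 : ℝ≥0∞).toReal)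
    with hm
  have hmtop : m ≠ ⊤ := by
    refine ENNReal.rpow_ne_top_of_nonneg ?_ (by simpa using hfin.ne)
    have h1 : (r : ℝ) ≤ 2 := by exact_mod_cast hr2.le
    have h2 : (0 : ℝ) < r := by exact_mod_cast (zero_lt_one.trans_le hr1)
    simpa using inv_anti₀ h2 h1
  refine ⟨eLpNormLESNormFDerivOfLeConst ℝ volume Ω r q * m.toNNReal, fun φ hφ => ?_⟩
  have hsupp : Function.support φ ⊆ Ω := (subset_tsupport φ).trans hφ.supp
  have hsupp' : Function.support (fderiv ℝ φ) ⊆ Ω :=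
    (support_fderiv_subset ℝ).trans hφ.supp
  have hsupp'' : Function.support (gradient φ) ⊆ Ω := fun x hx =>
    hsupp' fun h => hx (by simp [gradient, h])
  have h1 : eLpNorm φ q volume ≤ eLpNormLESNormFDerivOfLeConst ℝ volume Ω r q *
      eLpNorm (fderiv ℝ φ) r volume :=
    eLpNorm_le_eLpNorm_fderiv_of_le volume (hφ.smooth.of_le (by exact_mod_cast le_top)) hsupp
      hr1 hrd hrq hΩb
  have h2 : eLpNorm (fderiv ℝ φ) r volume = eLpNorm (gradient φ) r volume :=
    eLpNorm_congr_norm_ae (.of_forall fun x => by simp [gradient])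
  have h3 : eLpNorm (gradient φ) r (volume.restrict Ω) = eLpNorm (gradient φ) r volume :=
    eLpNorm_restrict_eq_of_support_subset hsupp''
  have h4 : eLpNorm φ q (volume.restrict Ω) = eLpNorm φ q volume :=
    eLpNorm_restrict_eq_of_support_subset hsupp
  have h5 : eLpNorm (gradient φ) r (volume.restrict Ω) ≤
      eLpNorm (gradient φ) 2 (volume.restrict Ω) * m :=
    eLpNorm_le_eLpNorm_mul_rpow_measure_univ (by exact_mod_cast hr2.le) (hφ.memLp_gradient 2).1
  rw [h4, ENNReal.coe_mul, ENNReal.coe_toNNReal hmtop, mul_assoc, mul_comm m]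
  refine h1.trans ?_
  rw [h2, ← h3]
  gcongr

/-- The gradient of a test function is its weak gradient. -/
theorem IsTest.hasWeakGradient {φ : EuclideanSpace ℝ (Fin d) → ℝ} (hφ : IsTest Ω φ) :
    HasWeakGradient Ω φ (gradient φ) := by
  intro ψ hψ
  have hs1 : Function.support (fun x => φ x • gradient ψ x) ⊆ Ω :=
    (Function.support_smul_subset_left _ _).trans ((subset_tsupport φ).trans hφ.supp)
  have hs2 : Function.support (fun x => ψ x • gradient φ x) ⊆ Ω :=
    (Function.support_smul_subset_left _ _).trans ((subset_tsupport ψ).trans hψ.supp)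
  have hi1 : Integrable (fun x => φ x • gradient ψ x) :=
    (hφ.smooth.continuous.smul hψ.continuous_gradient).integrable_of_hasCompactSupport
      hφ.compact.smul_right
  have hi2 : Integrable (fun x => ψ x • gradient φ x) :=
    (hψ.smooth.continuous.smul hφ.continuous_gradient).integrable_of_hasCompactSupport
      hψ.compact.smul_right
  have hi3 : Integrable (fun x => φ x • ψ x) :=
    (hφ.smooth.continuous.smul hψ.smooth.continuous).integrable_of_hasCompactSupport
      hφ.compact.smul_right
  rw [setIntegral_eq_integral_of_forall_compl_eq_zero
      (fun x hx => Function.notMem_support.1 fun h => hx (hs1 h)),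
    setIntegral_eq_integral_of_forall_compl_eq_zero
      (fun x hx => Function.notMem_support.1 fun h => hx (hs2 h))]
  refine ext_inner_right ℝ fun v => ?_
  rw [inner_neg_left, real_inner_comm, real_inner_comm v, ← integral_inner hi1,
    ← integral_inner hi2]
  have e1 : ∀ x, ⟪v, φ x • gradient ψ x⟫ = φ x • fderiv ℝ ψ x v := fun x => by
    rw [inner_smul_right, real_inner_comm, inner_gradient_left, smul_eq_mul]
  have e2 : ∀ x, ⟪v, ψ x • gradient φ x⟫ = fderiv ℝ φ x v • ψ x := fun x => by
    rw [inner_smul_right, real_inner_comm, inner_gradient_left, smul_eq_mul, mul_comm]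
  have hj1 := hi1.const_inner (𝕜 := ℝ) v
  have hj2 := hi2.const_inner (𝕜 := ℝ) v
  simp_rw [e1] at hj1
  simp_rw [e2] at hj2
  simp_rw [e1, e2]
  exact integral_smul_fderiv_eq_neg_fderiv_smul_of_integrable hj2 hj1 hi3
    (fun x _ => hφ.differentiable x) (fun x _ => hψ.differentiable x)

/-- The fundamental lemma of the calculus of variations; it gives uniqueness of weak gradients. -/
theorem ae_eq_of_forall_test (hΩo : IsOpen Ω) {g h : EuclideanSpace ℝ (Fin d) →
      EuclideanSpace ℝ (Fin d)} (hg : MemLp g 2 (volume.restrict Ω))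
    (hh : MemLp h 2 (volume.restrict Ω))
    (H : ∀ φ, IsTest Ω φ → ∫ x in Ω, φ x • g x = ∫ x in Ω, φ x • h x) :
    g =ᵐ[volume.restrict Ω] h := by
  have hloc : LocallyIntegrable (fun x => g x - h x) (volume.restrict Ω) :=
    (hg.sub hh).locallyIntegrable (by norm_num)
  have key := hΩo.ae_eq_zero_of_integral_contDiff_smul_eq_zero (μ := volume.restrict Ω)
    (hloc.locallyIntegrableOn Ω) (fun φ h1 h2 h3 => by
      have hφ : IsTest Ω φ := ⟨h1, h2, h3⟩
      have i1 : Integrable (fun x => φ x • g x) (volume.restrict Ω) :=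
        memLp_one_iff_integrable.1 (hg.smul (hφ.memLp 2))
      have i2 : Integrable (fun x => φ x • h x) (volume.restrict Ω) :=
        memLp_one_iff_integrable.1 (hh.smul (hφ.memLp 2))
      simp_rw [smul_sub]
      rw [integral_sub i1 i2, H φ hφ, sub_self])
  filter_upwards [key, ae_restrict_mem hΩo.measurableSet] with x hx hxm
  exact sub_eq_zero.1 (hx hxm)

theorem HasWeakGradient.congr {u u' : EuclideanSpace ℝ (Fin d) → ℝ}
    {g g' : EuclideanSpace ℝ (Fin d) → EuclideanSpace ℝ (Fin d)} (h : HasWeakGradient Ω u g)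
    (hu : u =ᵐ[volume.restrict Ω] u') (hg : g =ᵐ[volume.restrict Ω] g') :
    HasWeakGradient Ω u' g' := by
  intro φ hφ
  have e1 : ∫ x in Ω, u' x • gradient φ x = ∫ x in Ω, u x • gradient φ x :=
    integral_congr_ae (hu.mono fun x hx => by simp [hx])
  have e2 : ∫ x in Ω, φ x • g' x = ∫ x in Ω, φ x • g x :=
    integral_congr_ae (hg.mono fun x hx => by simp [hx])
  rw [e1, e2, h φ hφ]

theorem memLp_fn (w : H1 Ω) : MemLp (fn w) 2 (volume.restrict Ω) := Lp.memLp _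

theorem memLp_wgrad (w : H1 Ω) : MemLp (wgrad w) 2 (volume.restrict Ω) := Lp.memLp _

theorem wgrad_ae_eq (hΩo : IsOpen Ω) (w : H1 Ω)
    {u : EuclideanSpace ℝ (Fin d) → ℝ}
    {g : EuclideanSpace ℝ (Fin d) → EuclideanSpace ℝ (Fin d)}
    (hg : MemLp g 2 (volume.restrict Ω)) (hu : fn w =ᵐ[volume.restrict Ω] u)
    (h : HasWeakGradient Ω u g) : wgrad w =ᵐ[volume.restrict Ω] g := by
  refine ae_eq_of_forall_test hΩo (memLp_wgrad w) hg fun φ hφ => ?_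
  have h1 := h.congr hu.symm (EventuallyEq.refl _ g) φ hφ
  have h2 : ∫ x in Ω, fn w x • gradient φ x = - ∫ x in Ω, φ x • wgrad w x := w.2 φ hφ
  rw [h1] at h2
  exact (neg_injective h2).symm

/-- The weak gradient is determined by the function. This is what makes the product `σ v`, known
only through `IsProd`, a unique element of `H¹₀(Ω)`. -/
theorem H1_ext (hΩo : IsOpen Ω) {v w : H1 Ω} (h : fn v =ᵐ[volume.restrict Ω] fn w) : v = w := by
  have h2 := wgrad_ae_eq hΩo v (memLp_wgrad w) h w.2
  have e1 : v.1.fst = w.1.fst := Lp.ext h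
  have e2 : v.1.snd = w.1.snd := Lp.ext h2
  apply Subtype.ext
  apply (WithLp.equiv 2 _).injective
  exact Prod.ext e1 e2

theorem IsTest.exists_H1 {φ : EuclideanSpace ℝ (Fin d) → ℝ} (hφ : IsTest Ω φ) :
    ∃ w : H1 Ω, fn w =ᵐ[volume.restrict Ω] φ :=
  ⟨⟨WithLp.toLp 2 ((hφ.memLp 2).toLp φ, (hφ.memLp_gradient 2).toLp (gradient φ)),
    hφ.hasWeakGradient.congr (MemLp.coeFn_toLp (hφ.memLp 2)).symm
      (MemLp.coeFn_toLp (hφ.memLp_gradient 2)).symm⟩,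
    MemLp.coeFn_toLp (hφ.memLp 2)⟩

/-- The classes of test functions in `H¹(Ω)`. -/
def testSubmodule (Ω : Set (EuclideanSpace ℝ (Fin d))) : Submodule ℝ (H1 Ω) where
  carrier := {w | ∃ φ, IsTest Ω φ ∧ fn w =ᵐ[volume.restrict Ω] φ}
  add_mem' := by
    rintro a b ⟨φ, hφ, ha⟩ ⟨ψ, hψ, hb⟩
    refine ⟨φ + ψ, hφ.add hψ, ?_⟩
    filter_upwards [Lp.coeFn_add a.1.fst b.1.fst, ha, hb] with x hx hax hbx
    exact hx.trans (congrArg₂ (· + ·) hax hbx)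
  zero_mem' := ⟨0, IsTest.zero, Lp.coeFn_zero ℝ 2 (volume.restrict Ω)⟩
  smul_mem' := by
    rintro c a ⟨φ, hφ, ha⟩
    refine ⟨c • φ, hφ.const_smul c, ?_⟩
    filter_upwards [Lp.coeFn_smul c a.1.fst, ha] with x hx hax
    exact hx.trans (congrArg (c • ·) hax)

theorem H10_eq_topologicalClosure : H10 Ω = (testSubmodule Ω).topologicalClosure := by
  rw [H10]
  congr 1
  exact Submodule.span_eq (testSubmodule Ω)

theorem testSubmodule_le_H10 : testSubmodule Ω ≤ H10 Ω := by
  rw [H10_eq_topologicalClosure]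
  exact Submodule.le_topologicalClosure _

theorem H10_exists_seq (v : H10 Ω) : ∃ s : ℕ → H10 Ω, (∀ n, (s n).1 ∈ testSubmodule Ω) ∧
    Tendsto s atTop (𝓝 v) := by
  have hv : v.1 ∈ closure (testSubmodule Ω : Set (H1 Ω)) :=
    (SetLike.ext_iff.1 H10_eq_topologicalClosure v.1).1 v.2
  rw [mem_closure_iff_seq_limit] at hv
  obtain ⟨s, hs, hlim⟩ := hv
  refine ⟨fun n => ⟨s n, testSubmodule_le_H10 (SetLike.mem_coe.1 (hs n))⟩, fun n => ?_, ?_⟩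
  · exact SetLike.mem_coe.1 (hs n)
  · exact tendsto_subtype_rng.2 hlim

/-! ### The space `H¹₀(Ω)`: density of test functions and the Poincaré inequality. -/

/-- The normed space `H¹₀(Ω)`, with sealed instances. -/
def Sob (Ω : Set (EuclideanSpace ℝ (Fin d))) : Type := H10 Ω

instance : NormedAddCommGroup (Sob Ω) := inferInstanceAs (NormedAddCommGroup (H10 Ω))

instance : NormedSpace ℝ (Sob Ω) := inferInstanceAs (NormedSpace ℝ (H10 Ω))

/-- The class in `H¹(Ω)` of an element of `H¹₀(Ω)`. -/
def Sob.toH1 (v : Sob Ω) : H1 Ω := Subtype.val (p := fun w => w ∈ H10 Ω) v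

/-- The inclusion of `H¹₀(Ω)` into `L²(Ω)`. -/
def fnL (Ω : Set (EuclideanSpace ℝ (Fin d))) : Sob Ω →L[ℝ] Lp ℝ 2 (volume.restrict Ω) :=
  ((WithLp.fstL 2 ℝ _ _) ∘L (H1 Ω).subtypeL ∘L (H10 Ω).subtypeL :
    H10 Ω →L[ℝ] Lp ℝ 2 (volume.restrict Ω))

/-- The weak gradient, as an operator from `H¹₀(Ω)` to `L²(Ω)^d`. -/
def gradL (Ω : Set (EuclideanSpace ℝ (Fin d))) :
    Sob Ω →L[ℝ] Lp (EuclideanSpace ℝ (Fin d)) 2 (volume.restrict Ω) :=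
  ((WithLp.sndL 2 ℝ _ _) ∘L (H1 Ω).subtypeL ∘L (H10 Ω).subtypeL :
    H10 Ω →L[ℝ] Lp (EuclideanSpace ℝ (Fin d)) 2 (volume.restrict Ω))

/-- The class `v` contains a test function. -/
def Sob.IsTestClass (v : Sob Ω) : Prop :=
  ∃ φ, IsTest Ω φ ∧ fnL Ω v =ᵐ[volume.restrict Ω] φ

theorem Sob.norm_sq (v : Sob Ω) : ‖v‖ ^ 2 = ‖fnL Ω v‖ ^ 2 + ‖gradL Ω v‖ ^ 2 :=
  WithLp.prod_norm_sq_eq_of_L2 v.toH1.1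

theorem Sob.exists_seq (v : Sob Ω) : ∃ s : ℕ → Sob Ω, (∀ n, (s n).IsTestClass) ∧
    Tendsto s atTop (𝓝 v) :=
  H10_exists_seq v

theorem IsTest.exists_sob {φ : EuclideanSpace ℝ (Fin d) → ℝ} (hφ : IsTest Ω φ) :
    ∃ w : Sob Ω, fnL Ω w =ᵐ[volume.restrict Ω] φ := by
  obtain ⟨w, hw⟩ := hφ.exists_H1
  exact ⟨⟨w, testSubmodule_le_H10 ⟨φ, hφ, hw⟩⟩, hw⟩

theorem Sob.ext (hΩo : IsOpen Ω) {v w : Sob Ω} (h : fnL Ω v =ᵐ[volume.restrict Ω] fnL Ω w) :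
    v = w :=
  Subtype.ext (H1_ext hΩo h)

/-- A closed property of elements of `H¹₀(Ω)` holds as soon as it holds for test functions. -/
theorem Sob.induction {P : Sob Ω → Prop} (hP : IsClosed {v | P v})
    (h : ∀ v : Sob Ω, v.IsTestClass → P v) (v : Sob Ω) : P v := by
  obtain ⟨s, hs, hlim⟩ := v.exists_seq
  exact hP.mem_of_tendsto hlim (.of_forall fun n => h _ (hs n))

theorem norm_fnL_le (v : Sob Ω) : ‖fnL Ω v‖ ≤ ‖v‖ :=
  (sq_le_sq₀ (norm_nonneg _) (norm_nonneg _)).1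
    ((le_add_of_nonneg_right (sq_nonneg _)).trans_eq v.norm_sq.symm)

theorem norm_gradL_le (v : Sob Ω) : ‖gradL Ω v‖ ≤ ‖v‖ :=
  (sq_le_sq₀ (norm_nonneg _) (norm_nonneg _)).1
    ((le_add_of_nonneg_left (sq_nonneg _)).trans_eq v.norm_sq.symm)

theorem memLp_fnL (v : Sob Ω) : MemLp (fnL Ω v) 2 (volume.restrict Ω) := Lp.memLp _

theorem memLp_gradL (v : Sob Ω) : MemLp (gradL Ω v) 2 (volume.restrict Ω) := Lp.memLp _

theorem gradL_ae_eq (hΩo : IsOpen Ω) (w : Sob Ω)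
    {u : EuclideanSpace ℝ (Fin d) → ℝ}
    {g : EuclideanSpace ℝ (Fin d) → EuclideanSpace ℝ (Fin d)}
    (hg : MemLp g 2 (volume.restrict Ω)) (hu : fnL Ω w =ᵐ[volume.restrict Ω] u)
    (h : HasWeakGradient Ω u g) : gradL Ω w =ᵐ[volume.restrict Ω] g :=
  wgrad_ae_eq hΩo w.toH1 hg hu h

theorem IsTest.gradL_ae_eq {φ : EuclideanSpace ℝ (Fin d) → ℝ} (hφ : IsTest Ω φ)
    (hΩo : IsOpen Ω) {w : Sob Ω} (h : fnL Ω w =ᵐ[volume.restrict Ω] φ) :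
    gradL Ω w =ᵐ[volume.restrict Ω] gradient φ :=
  AdvDiff.gradL_ae_eq hΩo w (hφ.memLp_gradient 2) h hφ.hasWeakGradient

/-- Sobolev inequality for the elements of `H¹₀(Ω)` given by test functions. -/
theorem exists_eLpNorm_fnL_le (hd : 2 ≤ d) (hΩo : IsOpen Ω) (hΩb : Bornology.IsBounded Ω)
    (q : ℝ≥0) (hq : (1 / 2 : ℝ) - (d : ℝ)⁻¹ < (q : ℝ)⁻¹) :
    ∃ C : ℝ≥0, ∀ v : Sob Ω, v.IsTestClass →
      eLpNorm (fnL Ω v) q (volume.restrict Ω) ≤ C * ‖gradL Ω v‖ₑ := by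
  obtain ⟨C, hC⟩ := exists_eLpNorm_le_eLpNorm_gradient hd hΩb q hq
  refine ⟨C, fun v ⟨φ, hφ, hv⟩ => ?_⟩
  rw [Lp.enorm_def, eLpNorm_congr_ae hv, eLpNorm_congr_ae (hφ.gradL_ae_eq hΩo hv)]
  exact hC φ hφ

/-- Poincaré inequality. -/
theorem exists_norm_fnL_le (hd : 2 ≤ d) (hΩo : IsOpen Ω) (hΩb : Bornology.IsBounded Ω) :
    ∃ C : ℝ≥0, ∀ v : Sob Ω, ‖fnL Ω v‖ ≤ C * ‖gradL Ω v‖ := by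
  have hq : (1 / 2 : ℝ) - (d : ℝ)⁻¹ < ((2 : ℝ≥0) : ℝ)⁻¹ := by
    have : (0 : ℝ) < (d : ℝ)⁻¹ := by positivity
    norm_num
    omega
  obtain ⟨C, hC⟩ := exists_eLpNorm_fnL_le hd hΩo hΩb 2 hq
  refine ⟨C, Sob.induction (isClosed_le (by fun_prop) (by fun_prop)) fun v hv => ?_⟩
  have := hC v hv
  rw [ENNReal.coe_ofNat, ← Lp.enorm_def, enorm_eq_nnnorm, enorm_eq_nnnorm] at this
  rw [← coe_nnnorm, ← coe_nnnorm]
  exact_mod_cast this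

end Sobolev

/-! ### Multiplication operators on `H¹₀(Ω)`. -/

section Multipliers

variable {d : ℕ} {Ω : Set (EuclideanSpace ℝ (Fin d))}

/-- A bound for the multiplication by a field `B` from `H¹₀(Ω)` to `L²(Ω)^d` may be checked on test
functions. -/
theorem eLpNorm_fnL_smul_le {B : EuclideanSpace ℝ (Fin d) → EuclideanSpace ℝ (Fin d)}
    (hB : AEStronglyMeasurable B (volume.restrict Ω)) {K : ℝ≥0}
    (h : ∀ v : Sob Ω, v.IsTestClass →
      eLpNorm (fun x => fnL Ω v x • B x) 2 (volume.restrict Ω) ≤ K * ‖v‖ₑ) (v : Sob Ω) :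
    eLpNorm (fun x => fnL Ω v x • B x) 2 (volume.restrict Ω) ≤ K * ‖v‖ₑ := by
  obtain ⟨s, hs, hlim⟩ := v.exists_seq
  have h1 : Tendsto (fun n => fnL Ω (s n)) atTop (𝓝 (fnL Ω v)) :=
    ((fnL Ω).continuous.tendsto v).comp hlim
  -- A subsequence converges almost everywhere, so Fatou's lemma passes the bound to the limit
  -- without assuming that `v B` is square integrable.
  obtain ⟨k, hk, hae⟩ := (tendstoInMeasure_of_tendsto_Lp h1).exists_seq_tendsto_ae
  have h2 : Tendsto (fun n => (K : ℝ≥0∞) * ‖s (k n)‖ₑ) atTop (𝓝 (K * ‖v‖ₑ)) :=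
    ENNReal.Tendsto.const_mul ((hlim.comp hk.tendsto_atTop).enorm) (Or.inr ENNReal.coe_ne_top)
  refine (Lp.eLpNorm_lim_le_liminf_eLpNorm
    (f := fun n x => fnL Ω (s (k n)) x • B x) (fun n => (memLp_fnL _).1.smul hB) _ ?_).trans ?_
  · filter_upwards [hae] with x hx
    exact hx.smul_const _
  · refine (liminf_le_liminf (.of_forall fun n => h _ (hs (k n)))).trans_eq h2.liminf_eq

/-- As a bounded operator into `L²`, multiplication by `B` turns the advection terms into `L²` inner
products, continuous in both arguments, so that density arguments apply. -/
theorem exists_mulL {B : EuclideanSpace ℝ (Fin d) → EuclideanSpace ℝ (Fin d)}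
    (hB : AEStronglyMeasurable B (volume.restrict Ω)) {K : ℝ≥0}
    (h : ∀ v : Sob Ω, eLpNorm (fun x => fnL Ω v x • B x) 2 (volume.restrict Ω) ≤ K * ‖v‖ₑ) :
    ∃ M : Sob Ω →L[ℝ] Lp (EuclideanSpace ℝ (Fin d)) 2 (volume.restrict Ω),
      (∀ v, M v =ᵐ[volume.restrict Ω] fun x => fnL Ω v x • B x) ∧ ∀ v, ‖M v‖ ≤ K * ‖v‖ := by
  have hm : ∀ v : Sob Ω, MemLp (fun x => fnL Ω v x • B x) 2 (volume.restrict Ω) := fun v =>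
    ⟨(memLp_fnL v).1.smul hB, (h v).trans_lt (ENNReal.mul_lt_top ENNReal.coe_lt_top enorm_lt_top)⟩
  let L : Sob Ω →ₗ[ℝ] Lp (EuclideanSpace ℝ (Fin d)) 2 (volume.restrict Ω) :=
    { toFun := fun v => (hm v).toLp _
      map_add' := fun v w => by
        rw [← MemLp.toLp_add]
        refine MemLp.toLp_congr _ _ ?_
        rw [map_add]
        filter_upwards [Lp.coeFn_add (fnL Ω v) (fnL Ω w)] with x hx
        simp only [hx, Pi.add_apply, add_smul]
      map_smul' := fun c v => by
        rw [RingHom.id_apply, ← MemLp.toLp_const_smul]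
        refine MemLp.toLp_congr _ _ ?_
        rw [map_smul]
        filter_upwards [Lp.coeFn_smul c (fnL Ω v)] with x hx
        simp only [hx, Pi.smul_apply, smul_assoc] }
  have hL : ∀ v, ‖L v‖ ≤ K * ‖v‖ := fun v => by
    have h1 := h v
    rw [← Lp.enorm_toLp (hm v), enorm_eq_nnnorm, enorm_eq_nnnorm] at h1
    rw [← coe_nnnorm, ← coe_nnnorm]
    exact_mod_cast h1
  exact ⟨L.mkContinuous K hL, fun v => MemLp.coeFn_toLp (hm v), hL⟩

theorem exists_smul_gradL {s : EuclideanSpace ℝ (Fin d) → ℝ}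
    (hs : AEStronglyMeasurable s (volume.restrict Ω)) {S : ℝ≥0}
    (h : ∀ᵐ x ∂(volume.restrict Ω), ‖s x‖₊ ≤ S) :
    ∃ N : Sob Ω →L[ℝ] Lp (EuclideanSpace ℝ (Fin d)) 2 (volume.restrict Ω),
      (∀ v, N v =ᵐ[volume.restrict Ω] fun x => s x • gradL Ω v x) ∧ ∀ v, ‖N v‖ ≤ S * ‖v‖ := by
  have hb : ∀ v : Sob Ω, eLpNorm (fun x => s x • gradL Ω v x) 2 (volume.restrict Ω)
      ≤ S * eLpNorm (gradL Ω v) 2 (volume.restrict Ω) := fun v => by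
    refine eLpNorm_le_nnreal_smul_eLpNorm_of_ae_le_mul ?_ 2
    filter_upwards [h] with x hx
    rw [nnnorm_smul]
    gcongr
  have hm : ∀ v : Sob Ω, MemLp (fun x => s x • gradL Ω v x) 2 (volume.restrict Ω) := fun v =>
    ⟨hs.smul (memLp_gradL v).1,
      (hb v).trans_lt (ENNReal.mul_lt_top ENNReal.coe_lt_top (memLp_gradL v).2)⟩
  let L : Sob Ω →ₗ[ℝ] Lp (EuclideanSpace ℝ (Fin d)) 2 (volume.restrict Ω) :=
    { toFun := fun v => (hm v).toLp _
      map_add' := fun v w => by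
        rw [← MemLp.toLp_add]
        refine MemLp.toLp_congr _ _ ?_
        rw [map_add]
        filter_upwards [Lp.coeFn_add (gradL Ω v) (gradL Ω w)] with x hx
        simp only [hx, Pi.add_apply, smul_add]
      map_smul' := fun c v => by
        rw [RingHom.id_apply, ← MemLp.toLp_const_smul]
        refine MemLp.toLp_congr _ _ ?_
        rw [map_smul]
        filter_upwards [Lp.coeFn_smul c (gradL Ω v)] with x hx
        simp only [hx, Pi.smul_apply, smul_comm c] }
  have hL : ∀ v, ‖L v‖ ≤ S * ‖v‖ := fun v => by
    have h1 := hb v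
    rw [← Lp.enorm_toLp (hm v), ← Lp.enorm_def, enorm_eq_nnnorm, enorm_eq_nnnorm] at h1
    have h2 : ‖L v‖ ≤ S * ‖gradL Ω v‖ := by
      rw [← coe_nnnorm, ← coe_nnnorm]
      exact_mod_cast h1
    exact h2.trans (by gcongr; exact norm_gradL_le v)
  exact ⟨L.mkContinuous S hL, fun v => MemLp.coeFn_toLp (hm v), hL⟩

/-- The advection form is skew-symmetric when the field is divergence free. -/
theorem inner_mulL_add_inner_mulL (hΩo : IsOpen Ω)
    {B : EuclideanSpace ℝ (Fin d) → EuclideanSpace ℝ (Fin d)}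
    (hdiv : ∀ φ, IsTest Ω φ → ∫ x in Ω, ⟪B x, gradient φ x⟫ = 0)
    {M : Sob Ω →L[ℝ] Lp (EuclideanSpace ℝ (Fin d)) 2 (volume.restrict Ω)}
    (hM : ∀ v, M v =ᵐ[volume.restrict Ω] fun x => fnL Ω v x • B x) (u v : Sob Ω) :
    ⟪M v, gradL Ω u⟫ + ⟪M u, gradL Ω v⟫ = 0 := by
  -- By density in each argument, only test functions `φ`, `ψ` matter; there the sum is the integral
  -- of `B · ∇(φψ)`, and `φψ` is itself a test function.
  refine Sob.induction (P := fun u => ⟪M v, gradL Ω u⟫ + ⟪M u, gradL Ω v⟫ = 0)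
    (isClosed_eq (by fun_prop) continuous_const) (fun u hu => ?_) u
  refine Sob.induction (P := fun v => ⟪M v, gradL Ω u⟫ + ⟪M u, gradL Ω v⟫ = 0)
    (isClosed_eq (by fun_prop) continuous_const) (fun v hv => ?_) v
  obtain ⟨φ, hφ, hu⟩ := hu
  obtain ⟨ψ, hψ, hv⟩ := hv
  rw [L2.inner_def, L2.inner_def, ← integral_add (L2.integrable_inner _ _)
    (L2.integrable_inner _ _), ← hdiv _ (hφ.mul hψ)]
  refine integral_congr_ae ?_
  filter_upwards [hM u, hM v, hu, hv, hφ.gradL_ae_eq hΩo hu, hψ.gradL_ae_eq hΩo hv]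
    with x h1 h2 h3 h4 h5 h6
  rw [h1, h2, h3, h4, h5, h6, hφ.gradient_mul hψ, inner_add_right, inner_smul_left,
    inner_smul_left, inner_smul_right, inner_smul_right]
  simp [add_comm]

/-- A real-valued essential infimum is a true lower bound only if some lower bound exists. Otherwise
it is the supremum of the empty set, with default value `0`, which positivity excludes. -/
theorem infOn_le {σ : H1 Ω} (h : 0 < infOn σ) :
    ∀ᵐ x ∂(volume.restrict Ω), infOn σ ≤ fn σ x := by
  refine ae_essInf_le ?_
  rw [infOn, essInf_eq_sSup] at h
  rcases eq_empty_or_nonempty {a | volume.restrict Ω {x | fn σ x < a} = 0} with h0 | ⟨a, ha⟩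
  · rw [h0, Real.sSup_empty] at h
    exact absurd h (lt_irrefl _)
  · refine ⟨a, ?_⟩
    rw [eventually_map]
    refine measure_mono_null (fun x hx => ?_) ha
    exact not_le.1 (show ¬ a ≤ fn σ x from hx)

/-- A pointwise multiplier of `H¹₀(Ω)` is bounded. -/
theorem ae_nnnorm_le_of_multiplier (hΩo : IsOpen Ω) {s : EuclideanSpace ℝ (Fin d) → ℝ} {C : ℝ≥0} (hC : 0 < C)
    (h : ∀ v : Sob Ω, ∃ w : Sob Ω, (fnL Ω w =ᵐ[volume.restrict Ω] fun x => s x * fnL Ω v x) ∧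
      ‖w‖ ≤ C * ‖v‖) :
    ∀ᵐ x ∂(volume.restrict Ω), ‖s x‖₊ ≤ C := by
  have hC' : (0 : ℝ) < C := hC
  -- Multiplication by `s / C` does not increase the `H¹` norm, so neither do its iterates.
  have iter : ∀ (v : Sob Ω) (n : ℕ), ∃ w : Sob Ω,
      (fnL Ω w =ᵐ[volume.restrict Ω] fun x => ((C : ℝ)⁻¹ * s x) ^ n * fnL Ω v x) ∧
      ‖w‖ ≤ ‖v‖ := by
    intro v n
    induction n with
    | zero => exact ⟨v, .of_forall fun x => by simp, le_rfl⟩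
    | succ n ih =>
      obtain ⟨w, hw, hwn⟩ := ih
      obtain ⟨z, hz, hzn⟩ := h w
      refine ⟨(C : ℝ)⁻¹ • z, ?_, ?_⟩
      · rw [map_smul]
        filter_upwards [Lp.coeFn_smul (C : ℝ)⁻¹ (fnL Ω z), hw, hz] with x h1 h2 h3
        rw [h1, Pi.smul_apply, h3, h2, smul_eq_mul]
        ring
      · rw [norm_smul, Real.norm_of_nonneg (by positivity), inv_mul_le_iff₀ hC']
        exact hzn.trans (by gcongr)
  have key : ∀ φ, IsTest Ω φ → ∀ᵐ x ∂(volume.restrict Ω), φ x ≠ 0 → ‖s x‖₊ ≤ C := by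
    intro φ hφ
    obtain ⟨v, hv⟩ := hφ.exists_sob
    choose w hw hwn using iter v
    have hmeas : ∀ n, Measurable (fun x => ‖fnL Ω (w n) x‖ₑ ^ (2 : ℝ)) :=
      fun n => (Lp.stronglyMeasurable (fnL Ω (w n))).enorm.pow_const 2
    have hint : ∀ n, ∫⁻ x, ‖fnL Ω (w n) x‖ₑ ^ (2 : ℝ) ∂(volume.restrict Ω) ≤ ‖v‖ₑ ^ (2 : ℝ) := by
      intro n
      have h1 := eLpNorm_nnreal_pow_eq_lintegral (μ := volume.restrict Ω) (f := fnL Ω (w n))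
        (p := 2) two_ne_zero
      rw [ENNReal.coe_ofNat, ← Lp.enorm_def] at h1
      push_cast at h1
      rw [← h1]
      gcongr
      rw [enorm_le_iff_norm_le]
      exact (norm_fnL_le _).trans (hwn n)
    -- The functions `(s / C)^n φ` are bounded in `L²`, so by Fatou their squares have an almost
    -- everywhere finite lower limit. Where `|s| > C` and `φ ≠ 0` they grow geometrically, so that
    -- set is null.
    have hfatou := (lintegral_liminf_le (μ := volume.restrict Ω) hmeas).trans
      ((liminf_le_liminf (f := atTop) (.of_forall hint)).trans_eq (liminf_const _))
    have hlt := ae_lt_top (Measurable.liminf hmeas)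
      (hfatou.trans_lt (ENNReal.rpow_lt_top_of_nonneg (by norm_num) enorm_ne_top)).ne
    filter_upwards [hlt, ae_all_iff.2 hw, hv] with x h1 h2 h3 hx0
    by_contra! hlt'
    refine h1.ne (Tendsto.liminf_eq ?_)
    have hgt : 1 < (C : ℝ)⁻¹ * ‖s x‖ := by
      rw [lt_inv_mul_iff₀ hC', mul_one]
      exact_mod_cast hlt'
    have ht : Tendsto (fun n => ‖fnL Ω (w n) x‖) atTop atTop := by
      have : (fun n => ‖fnL Ω (w n) x‖) = fun n => ((C : ℝ)⁻¹ * ‖s x‖) ^ n * ‖φ x‖ := by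
        funext n
        rw [h2, h3, norm_mul, norm_pow, norm_mul, Real.norm_of_nonneg (by positivity)]
      rw [this]
      exact (tendsto_pow_atTop_atTop_of_one_lt hgt).atTop_mul_const (norm_pos_iff.2 hx0)
    have ht2 : Tendsto (fun n => ENNReal.ofReal (‖fnL Ω (w n) x‖)) atTop (𝓝 ⊤) :=
      ENNReal.tendsto_ofReal_atTop.comp ht
    simp_rw [ofReal_norm] at ht2
    have ht3 := (ENNReal.continuous_rpow_const (y := 2)).tendsto ⊤ |>.comp ht2
    rw [ENNReal.top_rpow_of_pos (by norm_num)] at ht3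
    exact ht3
  -- Every point of `Ω` has a neighbourhood on which some test function does not vanish, and null
  -- sets are detected locally.
  have hnull : volume.restrict Ω {x | x ∈ Ω ∧ ¬ ‖s x‖₊ ≤ C} = 0 := by
    refine measure_null_of_locally_null _ fun x hx => ?_
    obtain ⟨φ, h1, h2, h3, -, h5⟩ :=
      exists_contDiff_tsupport_subset (n := ⊤) (hΩo.mem_nhds hx.1)
    have hφ : IsTest Ω φ := ⟨h3, h2, h1⟩
    have hopen : {y | φ y ≠ 0} ∈ 𝓝 x :=
      (isOpen_ne_fun hφ.smooth.continuous continuous_const).mem_nhds (by simp [h5])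
    refine ⟨{y | y ∈ Ω ∧ ¬ ‖s y‖₊ ≤ C} ∩ {y | φ y ≠ 0},
      inter_mem self_mem_nhdsWithin (mem_nhdsWithin_of_mem_nhds hopen), ?_⟩
    refine measure_mono_null (fun y hy => ?_) (key φ hφ)
    exact fun hc => hy.1.2 (hc hy.2)
  filter_upwards [ae_restrict_mem hΩo.measurableSet, measure_eq_zero_iff_ae_notMem.1 hnull]
    with x hx hx'
  by_contra hcon
  exact hx' ⟨hx, hcon⟩

/-- Product rule for the weak gradient of `σ φ`. -/
theorem gradL_mul_ae_eq (hΩo : IsOpen Ω) (σ : H1 Ω) {φ : EuclideanSpace ℝ (Fin d) → ℝ}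
    (hφ : IsTest Ω φ) {w : Sob Ω}
    (hw : fnL Ω w =ᵐ[volume.restrict Ω] fun x => fn σ x * φ x) :
    gradL Ω w =ᵐ[volume.restrict Ω] fun x => fn σ x • gradient φ x + φ x • wgrad σ x := by
  have m1 : MemLp (fun x => fn σ x • gradient φ x) 2 (volume.restrict Ω) :=
    (hφ.memLp_gradient ⊤).smul (memLp_fn σ)
  have m2 : MemLp (fun x => φ x • wgrad σ x) 2 (volume.restrict Ω) :=
    (memLp_wgrad σ).smul (hφ.memLp ⊤)
  refine gradL_ae_eq hΩo w (m1.add m2) hw fun ψ hψ => ?_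
  have i1 : Integrable (fun x => fn σ x • gradient (φ * ψ) x) (volume.restrict Ω) :=
    (hφ.mul hψ).integrable_smul_gradient σ.1.fst
  have i2 : Integrable (fun x => ψ x • (fn σ x • gradient φ x)) (volume.restrict Ω) :=
    memLp_one_iff_integrable.1 (m1.smul (hψ.memLp 2))
  have i3 : Integrable (fun x => ψ x • (φ x • wgrad σ x)) (volume.restrict Ω) :=
    memLp_one_iff_integrable.1 (m2.smul (hψ.memLp 2))
  have hσ : ∫ x in Ω, fn σ x • gradient (φ * ψ) x = - ∫ x in Ω, (φ * ψ) x • wgrad σ x :=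
    σ.2 _ (hφ.mul hψ)
  have e1 : ∀ x, (fn σ x * φ x) • gradient ψ x =
      fn σ x • gradient (φ * ψ) x - ψ x • (fn σ x • gradient φ x) := fun x => by
    rw [hφ.gradient_mul hψ]
    module
  have e2 : ∀ x, (φ * ψ) x • wgrad σ x = ψ x • (φ x • wgrad σ x) := fun x => by
    rw [Pi.mul_apply]
    module
  simp_rw [e1, smul_add]
  simp_rw [e2] at hσ
  rw [integral_sub i1 i2, integral_add i2 i3, hσ]
  abel

end Multipliers

/-- Quasi-optimality of Galerkin approximations for a coercive form whose lower order part is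
skew-symmetric. -/
theorem mul_norm_sub_le_of_galerkin {V L : Type*} [NormedAddCommGroup V] [NormedSpace ℝ V]
    [NormedAddCommGroup L] [InnerProductSpace ℝ L] (G M N : V →L[ℝ] L) {m c S K : ℝ}
    (hm : 0 ≤ m) (hc : 0 ≤ c) (hS : 0 ≤ S) (hK : 0 ≤ K)
    (hN : ∀ v, ‖N v‖ ≤ S * ‖v‖) (hM : ∀ v, ‖M v‖ ≤ K * ‖v‖) (hG : ∀ v, ‖G v‖ ≤ ‖v‖)
    (hGc : ∀ v, ‖v‖ ^ 2 ≤ c * ‖G v‖ ^ 2) (hcoer : ∀ v, m * ‖G v‖ ^ 2 ≤ ⟪N v, G v⟫)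
    {u w v : V} (horth : ⟪N (u - w), G (v - w)⟫ +
      (⟪M (v - w), G (u - w)⟫ - ⟪M (u - w), G (v - w)⟫) / 2 = 0) :
    m * ‖u - w‖ ≤ c * (S + K) * ‖u - v‖ := by
  set e := u - w with he
  have hv : v - w = e - (u - v) := by rw [he]; abel
  rw [hv] at horth
  set z := u - v
  have b1 : ⟪N e, G z⟫ ≤ S * ‖e‖ * ‖z‖ :=
    (real_inner_le_norm _ _).trans (mul_le_mul (hN e) (hG z) (norm_nonneg _) (by positivity))
  have b2 : ⟪M z, G e⟫ ≤ K * ‖z‖ * ‖e‖ :=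
    (real_inner_le_norm _ _).trans (mul_le_mul (hM z) (hG e) (norm_nonneg _) (by positivity))
  have b3 : - ⟪M e, G z⟫ ≤ K * ‖e‖ * ‖z‖ :=
    (neg_le_abs _).trans ((abs_real_inner_le_norm _ _).trans
      (mul_le_mul (hM e) (hG z) (norm_nonneg _) (by positivity)))
  -- With `v - w = e - z`, the skew terms in `(e, e)` cancel. What remains is `⟪N e, G e⟫ = ⟪N e, G
  -- z⟫ + (⟪M z, G e⟫ - ⟪M e, G z⟫) / 2`.
  simp only [map_sub, inner_sub_left, inner_sub_right] at horth
  have h1 : m * ‖G e‖ ^ 2 ≤ (S + K) * ‖z‖ * ‖e‖ := by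
    have := hcoer e
    linarith
  have h2 : m * ‖e‖ * ‖e‖ ≤ c * (S + K) * ‖z‖ * ‖e‖ := by
    have h3 := mul_le_mul_of_nonneg_left (hGc e) hm
    have h4 := mul_le_mul_of_nonneg_left h1 hc
    linarith
  rcases (norm_nonneg e).eq_or_lt with h0 | h0
  · rw [← h0, mul_zero]
    positivity
  · exact le_of_mul_le_mul_right h2 h0

/-! ### Bounds for the field `∇σ + σ b`, and quasi-optimality for the concrete forms. -/

section Forms

variable {d : ℕ} {Ω : Set (EuclideanSpace ℝ (Fin d))}

theorem aestronglyMeasurable_field (hΩo : IsOpen Ω)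
    {b : EuclideanSpace ℝ (Fin d) → EuclideanSpace ℝ (Fin d)} (hb : ContinuousOn b Ω)
    (σ : H1 Ω) : AEStronglyMeasurable (field b σ) (volume.restrict Ω) :=
  (memLp_wgrad σ).1.add ((memLp_fn σ).1.smul (hb.aestronglyMeasurable hΩo.measurableSet))

/-- The multiplier property of `σ` bounds the multiplication by `∇σ + σ b` on test functions. -/
theorem eLpNorm_fnL_smul_field_le_of_multiplier (hΩo : IsOpen Ω)
    {b : EuclideanSpace ℝ (Fin d) → EuclideanSpace ℝ (Fin d)} (hb : ContinuousOn b Ω)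
    {β : ℝ≥0} (hβ : ∀ x ∈ Ω, ‖b x‖₊ ≤ β) (σ : H1 Ω) {C S : ℝ≥0}
    (h : ∀ v : Sob Ω, ∃ w : Sob Ω,
      (fnL Ω w =ᵐ[volume.restrict Ω] fun x => fn σ x * fnL Ω v x) ∧ ‖w‖ ≤ C * ‖v‖)
    (hS : ∀ᵐ x ∂(volume.restrict Ω), ‖fn σ x‖₊ ≤ S) (v : Sob Ω) (hv : v.IsTestClass) :
    eLpNorm (fun x => fnL Ω v x • field b σ x) 2 (volume.restrict Ω) ≤
      (C + S + S * β : ℝ≥0) * ‖v‖ₑ := by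
  obtain ⟨φ, hφ, hv⟩ := hv
  obtain ⟨w, hw, hwn⟩ := h v
  have hw' : fnL Ω w =ᵐ[volume.restrict Ω] fun x => fn σ x * φ x := by
    filter_upwards [hw, hv] with x h1 h2
    rw [h1, h2]
  have hbm := hb.aestronglyMeasurable (μ := volume) hΩo.measurableSet
  -- By the product rule, `v B = ∇(σ v) - σ ∇v + v σ b`. The three terms are bounded by `C`, `S` and
  -- `S β` times the norm of `v`, with no `L^p` bound on `∇σ`.
  have heq : (fun x => fnL Ω v x • field b σ x) =ᵐ[volume.restrict Ω]
      ((gradL Ω w : EuclideanSpace ℝ (Fin d) → EuclideanSpace ℝ (Fin d))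
        - fun x => fn σ x • gradL Ω v x) + fun x => fnL Ω v x • fn σ x • b x := by
    filter_upwards [hv, hφ.gradL_ae_eq hΩo hv, gradL_mul_ae_eq hΩo σ hφ hw'] with x h1 h2 h3
    rw [Pi.add_apply, Pi.sub_apply, h1, h2, h3, field]
    module
  have a2 : AEStronglyMeasurable (fun x => fn σ x • gradL Ω v x) (volume.restrict Ω) :=
    (memLp_fn σ).1.smul (memLp_gradL v).1
  have a3 : AEStronglyMeasurable (fun x => fnL Ω v x • fn σ x • b x) (volume.restrict Ω) :=
    (memLp_fnL v).1.smul ((memLp_fn σ).1.smul hbm)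
  have n1 : eLpNorm (gradL Ω w) 2 (volume.restrict Ω) ≤ C * ‖v‖ₑ := by
    rw [← Lp.enorm_def, enorm_eq_nnnorm, enorm_eq_nnnorm]
    have : ‖gradL Ω w‖₊ ≤ C * ‖v‖₊ := (norm_gradL_le w).trans hwn
    exact_mod_cast this
  have n2 : eLpNorm (fun x => fn σ x • gradL Ω v x) 2 (volume.restrict Ω) ≤ S * ‖v‖ₑ := by
    refine (eLpNorm_le_nnreal_smul_eLpNorm_of_ae_le_mul (c := S) (g := gradL Ω v) ?_ 2).trans ?_
    · filter_upwards [hS] with x hx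
      rw [nnnorm_smul]
      gcongr
    · rw [← Lp.enorm_def]
      refine mul_le_mul_right (α := ℝ≥0∞) ?_ _
      exact enorm_le_iff_norm_le.2 (norm_gradL_le v)
  have n3 : eLpNorm (fun x => fnL Ω v x • fn σ x • b x) 2 (volume.restrict Ω) ≤
      (S * β : ℝ≥0) * ‖v‖ₑ := by
    refine (eLpNorm_le_nnreal_smul_eLpNorm_of_ae_le_mul (c := S * β) (g := fnL Ω v) ?_ 2).trans ?_
    · filter_upwards [hS, ae_restrict_mem hΩo.measurableSet] with x hx hxm
      rw [nnnorm_smul, nnnorm_smul, mul_comm]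
      gcongr
      exact hβ x hxm
    · rw [← Lp.enorm_def]
      refine mul_le_mul_right (α := ℝ≥0∞) ?_ _
      exact enorm_le_iff_norm_le.2 (norm_fnL_le v)
  rw [eLpNorm_congr_ae heq]
  refine (eLpNorm_add_le ((memLp_gradL w).1.sub a2) a3 (by norm_num)).trans ?_
  refine (add_le_add ((eLpNorm_sub_le (memLp_gradL w).1 a2 (by norm_num)).trans
    (add_le_add n1 n2)) n3).trans_eq ?_
  rw [ENNReal.coe_add, ENNReal.coe_add, add_mul, add_mul]

/-- Take `1/q = 1/2 - 1/p`: the condition `p > d` says exactly that `q` is subcritical for Sobolev.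
The case `p = ∞` is included, with `q = 2`. -/
theorem exists_holderTriple_of_lt (hd : 2 ≤ d) {p : ℝ≥0∞} (hp : (d : ℝ≥0∞) < p) :
    ∃ q : ℝ≥0, ENNReal.HolderTriple q p 2 ∧ (1 / 2 : ℝ) - (d : ℝ)⁻¹ < (q : ℝ)⁻¹ := by
  have hd0 : (0 : ℝ) < d := by positivity
  have hp0 : p ≠ 0 := (zero_le.trans_lt hp).ne'
  have hpi : p⁻¹ ≠ ⊤ := ENNReal.inv_ne_top.2 hp0
  set t : ℝ := p⁻¹.toReal with ht
  have ht0 : 0 ≤ t := ENNReal.toReal_nonneg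
  have htd : t < (d : ℝ)⁻¹ := by
    have h1 : p⁻¹ < (d : ℝ≥0∞)⁻¹ := ENNReal.inv_lt_inv.2 hp
    have h2 := (ENNReal.toReal_lt_toReal hpi (ENNReal.inv_ne_top.2 (by positivity))).2 h1
    rwa [← ht, ENNReal.toReal_inv, ENNReal.toReal_natCast] at h2
  have hd2 : (d : ℝ)⁻¹ ≤ 1 / 2 := by
    rw [inv_le_comm₀ hd0 (by norm_num)]
    norm_num
    exact_mod_cast hd
  have hpos : 0 < 1 / 2 - t := by linarith
  have hqne : (1 / 2 - t).toNNReal⁻¹ ≠ 0 := inv_ne_zero (by simpa using hpos)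
  refine ⟨(1 / 2 - t).toNNReal⁻¹, ⟨?_⟩, ?_⟩
  · rw [← ENNReal.coe_inv hqne, inv_inv, ← ENNReal.ofReal, ← ENNReal.ofReal_toReal hpi, ← ht,
      ← ENNReal.ofReal_add hpos.le ht0, sub_add_cancel, one_div,
      ENNReal.ofReal_inv_of_pos (by norm_num), ENNReal.ofReal_ofNat]
  · rw [NNReal.coe_inv, inv_inv, Real.coe_toNNReal _ hpos.le]
    linarith

/-- For `p > d`, an `Lᵖ` field is a multiplier from `H¹₀(Ω)` to `L²(Ω)`. -/
theorem exists_eLpNorm_fnL_smul_le (hd : 2 ≤ d) (hΩo : IsOpen Ω) (hΩb : Bornology.IsBounded Ω)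
    {p : ℝ≥0∞} (hp : (d : ℝ≥0∞) < p) :
    ∃ C : ℝ≥0, ∀ B : EuclideanSpace ℝ (Fin d) → EuclideanSpace ℝ (Fin d),
      AEStronglyMeasurable B (volume.restrict Ω) → ∀ v : Sob Ω, v.IsTestClass →
      eLpNorm (fun x => fnL Ω v x • B x) 2 (volume.restrict Ω) ≤
        C * eLpNorm B p (volume.restrict Ω) * ‖v‖ₑ := by
  obtain ⟨q, hq, hqd⟩ := exists_holderTriple_of_lt hd hp
  obtain ⟨C, hC⟩ := exists_eLpNorm_fnL_le hd hΩo hΩb q hqd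
  refine ⟨C, fun B hB v hv => ?_⟩
  have h1 : eLpNorm (fun x => fnL Ω v x • B x) 2 (volume.restrict Ω) ≤
      eLpNorm (fnL Ω v) q (volume.restrict Ω) * eLpNorm B p (volume.restrict Ω) :=
    eLpNorm_smul_le_mul_eLpNorm (p := q) (q := p) (r := 2) (f := B)
      (φ := fun x => fnL Ω v x) hB (memLp_fnL v).1
  have h2 : ‖gradL Ω v‖ₑ ≤ ‖v‖ₑ := enorm_le_iff_norm_le.2 (norm_gradL_le v)
  have h3 : eLpNorm (fnL Ω v) q (volume.restrict Ω) ≤ C * ‖v‖ₑ :=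
    (hC v hv).trans (by gcongr)
  refine h1.trans ((mul_le_mul_left h3 _).trans_eq ?_)
  rw [mul_right_comm]

theorem integral_skew_form_eq {s : EuclideanSpace ℝ (Fin d) → ℝ}
    {B : EuclideanSpace ℝ (Fin d) → EuclideanSpace ℝ (Fin d)}
    {M N : Sob Ω →L[ℝ] Lp (EuclideanSpace ℝ (Fin d)) 2 (volume.restrict Ω)}
    (hM : ∀ v, M v =ᵐ[volume.restrict Ω] fun x => fnL Ω v x • B x)
    (hN : ∀ v, N v =ᵐ[volume.restrict Ω] fun x => s x • gradL Ω v x) (u v : Sob Ω) :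
    ∫ x in Ω, (s x * ⟪gradL Ω u x, gradL Ω v x⟫ +
      ⟪B x, fnL Ω v x • gradL Ω u x - fnL Ω u x • gradL Ω v x⟫ / 2)
      = ⟪N u, gradL Ω v⟫ + (⟪M v, gradL Ω u⟫ - ⟪M u, gradL Ω v⟫) / 2 := by
  rw [L2.inner_def, L2.inner_def, L2.inner_def, ← integral_sub (L2.integrable_inner _ _)
    (L2.integrable_inner _ _), ← integral_div, ← integral_add (L2.integrable_inner _ _)
    (((L2.integrable_inner _ _).sub (L2.integrable_inner _ _)).div_const 2)]
  refine integral_congr_ae ?_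
  filter_upwards [hM u, hM v, hN u] with x h1 h2 h3
  rw [h1, h2, h3]
  simp only [inner_sub_right, inner_smul_left, inner_smul_right, conj_trivial]

theorem integral_form_eq {s : EuclideanSpace ℝ (Fin d) → ℝ}
    {B : EuclideanSpace ℝ (Fin d) → EuclideanSpace ℝ (Fin d)}
    {M N : Sob Ω →L[ℝ] Lp (EuclideanSpace ℝ (Fin d)) 2 (volume.restrict Ω)}
    (hM : ∀ v, M v =ᵐ[volume.restrict Ω] fun x => fnL Ω v x • B x)
    (hN : ∀ v, N v =ᵐ[volume.restrict Ω] fun x => s x • gradL Ω v x) (u v : Sob Ω) :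
    ∫ x in Ω, (s x * ⟪gradL Ω u x, gradL Ω v x⟫ + ⟪B x, gradL Ω u x⟫ * fnL Ω v x)
      = ⟪N u, gradL Ω v⟫ + ⟪M v, gradL Ω u⟫ := by
  rw [L2.inner_def, L2.inner_def, ← integral_add (L2.integrable_inner _ _)
    (L2.integrable_inner _ _)]
  refine integral_congr_ae ?_
  filter_upwards [hM v, hN u] with x h1 h2
  rw [h1, h2]
  simp only [inner_smul_left, conj_trivial]
  ring

theorem mul_norm_gradL_sq_le {m : ℝ} {s : EuclideanSpace ℝ (Fin d) → ℝ}
    (hs : ∀ᵐ x ∂(volume.restrict Ω), m ≤ s x)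
    {N : Sob Ω →L[ℝ] Lp (EuclideanSpace ℝ (Fin d)) 2 (volume.restrict Ω)}
    (hN : ∀ v, N v =ᵐ[volume.restrict Ω] fun x => s x • gradL Ω v x) (v : Sob Ω) :
    m * ‖gradL Ω v‖ ^ 2 ≤ ⟪N v, gradL Ω v⟫ := by
  rw [← real_inner_self_eq_norm_sq, L2.inner_def, L2.inner_def, ← integral_const_mul]
  refine integral_mono_ae ((L2.integrable_inner _ _).const_mul _) (L2.integrable_inner _ _) ?_
  filter_upwards [hN v, hs] with x h1 h2
  rw [h1, inner_smul_left, conj_trivial]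
  exact mul_le_mul_of_nonneg_right h2 real_inner_self_nonneg

/-- Quasi-optimality of the discrete solution, given a bound for the multiplication by `B` from
`H¹₀(Ω)` to `L²(Ω)`. -/
theorem mul_norm_sub_le_of_form (hΩo : IsOpen Ω) {s : EuclideanSpace ℝ (Fin d) → ℝ}
    {B : EuclideanSpace ℝ (Fin d) → EuclideanSpace ℝ (Fin d)}
    (hsm : AEStronglyMeasurable s (volume.restrict Ω))
    (hBm : AEStronglyMeasurable B (volume.restrict Ω))
    (hdiv : ∀ φ, IsTest Ω φ → ∫ x in Ω, ⟪B x, gradient φ x⟫ = 0)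
    {m : ℝ} (hm : 0 ≤ m) {S K C : ℝ≥0}
    (hms : ∀ᵐ x ∂(volume.restrict Ω), m ≤ s x) (hS : ∀ᵐ x ∂(volume.restrict Ω), ‖s x‖₊ ≤ S)
    (hK : ∀ v : Sob Ω, v.IsTestClass →
      eLpNorm (fun x => fnL Ω v x • B x) 2 (volume.restrict Ω) ≤ K * ‖v‖ₑ)
    (hC : ∀ v : Sob Ω, ‖fnL Ω v‖ ≤ C * ‖gradL Ω v‖) {f : Sob Ω → ℝ} {u uH v : Sob Ω}
    (hu : ∃ w : Sob Ω, (fnL Ω w =ᵐ[volume.restrict Ω] fun x => s x * fnL Ω (v - uH) x) ∧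
      ∫ x in Ω, (s x * ⟪gradL Ω u x, gradL Ω (v - uH) x⟫ +
        ⟪B x, gradL Ω u x⟫ * fnL Ω (v - uH) x) = f w)
    (huH : ∃ w : Sob Ω, (fnL Ω w =ᵐ[volume.restrict Ω] fun x => s x * fnL Ω (v - uH) x) ∧
      ∫ x in Ω, (s x * ⟪gradL Ω uH x, gradL Ω (v - uH) x⟫ +
        ⟪B x, fnL Ω (v - uH) x • gradL Ω uH x - fnL Ω uH x • gradL Ω (v - uH) x⟫ / 2) = f w) :
    m * ‖u - uH‖ ≤ (1 + C ^ 2) * (S + K) * ‖u - v‖ := by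
  obtain ⟨M, hM, hMn⟩ := exists_mulL hBm (eLpNorm_fnL_smul_le hBm hK)
  obtain ⟨N, hN, hNn⟩ := exists_smul_gradL hsm hS
  -- Consistency: skew-symmetry rewrites the equation for `u` in terms of `a_ss`. Both right-hand
  -- sides agree because the two representatives of `σ (v - u_H)` coincide.
  have horth : ⟪N u, gradL Ω (v - uH)⟫ +
      (⟪M (v - uH), gradL Ω u⟫ - ⟪M u, gradL Ω (v - uH)⟫) / 2 =
      ⟪N uH, gradL Ω (v - uH)⟫ +
      (⟪M (v - uH), gradL Ω uH⟫ - ⟪M uH, gradL Ω (v - uH)⟫) / 2 := by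
    obtain ⟨w, hw, h1⟩ := huH
    obtain ⟨w', hw', h2⟩ := hu
    rw [integral_skew_form_eq hM hN] at h1
    rw [integral_form_eq hM hN] at h2
    rw [h1, Sob.ext hΩo (hw.trans hw'.symm), ← h2]
    have := inner_mulL_add_inner_mulL hΩo hdiv hM u (v - uH)
    linarith
  refine mul_norm_sub_le_of_galerkin (gradL Ω) M N hm (by positivity) S.2 K.2 hNn hMn
    norm_gradL_le (fun v => ?_) (mul_norm_gradL_sq_le hms hN) ?_
  -- The factor `1 + C²` comes from Poincaré: the full squared norm is at most `(1 + C²)` times that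
  -- of the gradient.
  · rw [v.norm_sq, add_mul, one_mul, add_comm, ← mul_pow]
    gcongr
    exact hC v
  · rw [map_sub N u, map_sub M u, map_sub (gradL Ω) u, inner_sub_left, inner_sub_left,
      inner_sub_right]
    linarith

/-- An element of `H¹₀(Ω)`, in the sealed copy of this space. -/
def Sob.ofH10 (v : H10 Ω) : Sob Ω := v

theorem infOn_mul_norm_sub_le (hΩo : IsOpen Ω)
    {b : EuclideanSpace ℝ (Fin d) → EuclideanSpace ℝ (Fin d)} (hb : ContinuousOn b Ω)
    {σ : H1 Ω} (hσ : IsInvariantMeasure b σ) {f : HNeg1 Ω} {UH : Submodule ℝ (H10 Ω)}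
    {u uH : H10 Ω} (hu : IsModifiedSolution b σ f u) (huH : IsDiscreteSolution b σ f UH uH)
    {S K C : ℝ≥0} (hS : ∀ᵐ x ∂(volume.restrict Ω), ‖fn σ x‖₊ ≤ S)
    (hK : ∀ v : Sob Ω, v.IsTestClass →
      eLpNorm (fun x => fnL Ω v x • field b σ x) 2 (volume.restrict Ω) ≤ K * ‖v‖ₑ)
    (hC : ∀ v : Sob Ω, ‖fnL Ω v‖ ≤ C * ‖gradL Ω v‖) (v : H10 Ω) (hv : v ∈ UH) :
    infOn σ * ‖u - uH‖ ≤ (1 + C ^ 2) * (S + K) * ‖u - v‖ :=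
  mul_norm_sub_le_of_form hΩo (memLp_fn σ).1 (aestronglyMeasurable_field hΩo hb σ) hσ.adjoint
    hσ.pos.le (infOn_le hσ.pos) hS hK hC (f := fun w => f w) (u := Sob.ofH10 u)
    (uH := Sob.ofH10 uH) (v := Sob.ofH10 v) (hu (v - uH)) (huH.2 (v - uH) (UH.sub_mem hv huH.1))

theorem IsInvariantMeasure.exists_multiplier
    {b : EuclideanSpace ℝ (Fin d) → EuclideanSpace ℝ (Fin d)} {σ : H1 Ω}
    (hσ : IsInvariantMeasure b σ) : ∃ C : ℝ≥0, 0 < C ∧ ∀ v : Sob Ω, ∃ w : Sob Ω,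
      (fnL Ω w =ᵐ[volume.restrict Ω] fun x => fn σ x * fnL Ω v x) ∧ ‖w‖ ≤ C * ‖v‖ := by
  obtain ⟨C, hC⟩ := hσ.mult
  have hC' : ∀ v : Sob Ω, ∃ w : Sob Ω,
      (fnL Ω w =ᵐ[volume.restrict Ω] fun x => fn σ x * fnL Ω v x) ∧ ‖w‖ ≤ C * ‖v‖ := hC
  -- The given constant is an arbitrary real; enlarging it makes it positive, so that `s` can be
  -- divided by it.
  refine ⟨max C.toNNReal 1, by positivity, fun v => ?_⟩
  obtain ⟨w, hw, hwn⟩ := hC' v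
  refine ⟨w, hw, hwn.trans ?_⟩
  gcongr
  exact (Real.le_coe_toNNReal C).trans (by exact_mod_cast le_max_left _ _)

end Forms

/-! ### The estimate in `[0, ∞]` and the theorem. -/

variable {d : ℕ} {Ω : Set (EuclideanSpace ℝ (Fin d))}

theorem enorm_sub_le_mul_iInf (hΩo : IsOpen Ω) (hΩb : Bornology.IsBounded Ω) {p : ℝ≥0∞}
    {b : EuclideanSpace ℝ (Fin d) → EuclideanSpace ℝ (Fin d)} {L : ℝ≥0}
    (hbL : LipschitzOnWith L b (closure Ω)) {σ : H1 Ω} (hσ : IsInvariantMeasure b σ) {CP CS : ℝ≥0}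
    (hCS : ∀ B : EuclideanSpace ℝ (Fin d) → EuclideanSpace ℝ (Fin d),
      AEStronglyMeasurable B (volume.restrict Ω) → ∀ v : Sob Ω, v.IsTestClass →
      eLpNorm (fun x => fnL Ω v x • B x) 2 (volume.restrict Ω) ≤
        CS * eLpNorm B p (volume.restrict Ω) * ‖v‖ₑ)
    {u uH : Sob Ω} {ι : Type*} [Nonempty ι] {g : ι → Sob Ω}
    (hmain : ∀ S K : ℝ≥0, (∀ᵐ x ∂(volume.restrict Ω), ‖fn σ x‖₊ ≤ S) →
      (∀ v : Sob Ω, v.IsTestClass →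
        eLpNorm (fun x => fnL Ω v x • field b σ x) 2 (volume.restrict Ω) ≤ K * ‖v‖ₑ) →
      ∀ i, infOn σ * ‖u - uH‖ ≤ (1 + CP ^ 2) * (S + K) * ‖u - g i‖) :
    ‖u - uH‖ₑ ≤ ((1 + CP ^ 2) * max 1 CS : ℝ≥0) *
      ((eLpNorm (fn σ) ⊤ (volume.restrict Ω) + eLpNorm (field b σ) p (volume.restrict Ω))
        / ENNReal.ofReal (infOn σ)) * ⨅ i, ‖u - g i‖ₑ := by
  have hbc : ContinuousOn b Ω := hbL.continuousOn.mono subset_closure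
  obtain ⟨β, hβ⟩ := hΩb.isCompact_closure.exists_bound_of_continuousOn hbL.continuousOn
  have hβ' : ∀ x ∈ Ω, ‖b x‖₊ ≤ β.toNNReal := fun x hx =>
    (hβ x (subset_closure hx)).trans (Real.le_coe_toNNReal β)
  have hBm := aestronglyMeasurable_field hΩo hbc σ
  obtain ⟨Cm, hCm0, hCm⟩ := hσ.exists_multiplier
  have hSm := ae_nnnorm_le_of_multiplier hΩo hCm0 hCm
  have hσtop : eLpNorm (fn σ) ⊤ (volume.restrict Ω) ≠ ⊤ :=
    (memLp_top_of_bound (memLp_fn σ).1 Cm hSm).2.ne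
  have hS : ∀ᵐ x ∂(volume.restrict Ω), ‖fn σ x‖₊ ≤
      (eLpNorm (fn σ) ⊤ (volume.restrict Ω)).toNNReal := by
    filter_upwards [ae_le_eLpNormEssSup (f := fn σ) (μ := volume.restrict Ω)] with x hx
    rw [← eLpNorm_exponent_top, ← ENNReal.coe_toNNReal hσtop] at hx
    exact_mod_cast hx
  set S := (eLpNorm (fn σ) ⊤ (volume.restrict Ω)).toNNReal with hSdef
  have hSc : eLpNorm (fn σ) ⊤ (volume.restrict Ω) = S := (ENNReal.coe_toNNReal hσtop).symm
  have hm0 : ENNReal.ofReal (infOn σ) ≠ 0 := by simpa using hσ.pos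
  have main : ∀ K : ℝ≥0, (∀ v : Sob Ω, v.IsTestClass →
      eLpNorm (fun x => fnL Ω v x • field b σ x) 2 (volume.restrict Ω) ≤
        K * ‖v‖ₑ) →
      ‖u - uH‖ₑ ≤ ((1 + CP ^ 2) * (S + K) : ℝ≥0) / ENNReal.ofReal (infOn σ) *
        ⨅ i, ‖u - g i‖ₑ := by
    intro K hK
    -- The infimum need not be attained; it commutes with the factor because the latter is finite.
    rw [ENNReal.mul_iInf (fun h => absurd h (ENNReal.div_ne_top ENNReal.coe_ne_top hm0))]
    refine le_iInf fun i => ?_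
    have h := hmain S K hS hK i
    rw [← ENNReal.mul_div_right_comm, ENNReal.le_div_iff_mul_le (Or.inl hm0)
      (Or.inl ENNReal.ofReal_ne_top), ← ofReal_norm, ← ofReal_norm, ← ENNReal.ofReal_coe_nnreal,
      ← ENNReal.ofReal_mul (norm_nonneg _), ← ENNReal.ofReal_mul (NNReal.coe_nonneg _)]
    refine ENNReal.ofReal_le_ofReal ?_
    rw [mul_comm]
    exact_mod_cast h
  rw [hSc]
  by_cases hB : eLpNorm (field b σ) p (volume.restrict Ω) = ⊤
  · rw [hB, add_top, ENNReal.top_div_of_ne_top ENNReal.ofReal_ne_top,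
      ENNReal.mul_top (by positivity)]
    -- Here `‖B‖_{L^p} = ∞`, so the bound has content only if the infimum is zero. It then asserts
    -- `u = u_H`, which follows from the finite constant supplied by (C3), whose size is irrelevant.
    rcases eq_or_ne (⨅ i, ‖u - g i‖ₑ) 0 with h0 | h0
    · have h := main _ (eLpNorm_fnL_smul_field_le_of_multiplier hΩo hbc hβ' σ hCm hSm)
      rw [h0, mul_zero] at h ⊢
      exact h
    · rw [ENNReal.top_mul h0]
      exact le_top
  · have h := main (CS * (eLpNorm (field b σ) p (volume.restrict Ω)).toNNReal)
      (fun v hv => by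
        rw [ENNReal.coe_mul, ENNReal.coe_toNNReal hB]
        exact hCS _ hBm v hv)
    refine h.trans (mul_le_mul_left ?_ _)
    rw [← ENNReal.coe_toNNReal hB, mul_div_assoc', ← ENNReal.coe_add, ← ENNReal.coe_mul]
    refine ENNReal.div_le_div_right (ENNReal.coe_le_coe.2 ?_) _
    -- `S + CS ‖B‖ ≤ max 1 CS * (S + ‖B‖)`, which explains the final constant.
    rw [mul_assoc, mul_add (max 1 CS)]
    gcongr
    · exact le_mul_of_one_le_left zero_le (le_max_left _ _)
    · exact le_max_right _ _
    · exact ENNReal.coe_toNNReal_le_self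

end AdvDiff

end

theorem proposition3p2 (d : ℕ) (hd : 2 ≤ d) (Ω : Set (EuclideanSpace ℝ (Fin d)))
    (hΩo : IsOpen Ω) (hΩb : Bornology.IsBounded Ω) (hΩc : IsConnected Ω)
    (hΩ2 : AdvDiff.IsC2Domain Ω) (p : ℝ≥0∞) (hp : (d : ℝ≥0∞) < p) :
    ∃ C : ℝ≥0, ∀ (b : EuclideanSpace ℝ (Fin d) → EuclideanSpace ℝ (Fin d)),
      (∃ L : ℝ≥0, LipschitzOnWith L b (closure Ω)) →
      ∀ (σ : AdvDiff.H1 Ω), AdvDiff.IsInvariantMeasure b σ →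
      ∀ (f : AdvDiff.HNeg1 Ω) (UH : Submodule ℝ (AdvDiff.H10 Ω)) (u uH : AdvDiff.H10 Ω),
        AdvDiff.IsModifiedSolution b σ f u →
        AdvDiff.IsDiscreteSolution b σ f UH uH →
        ‖u - uH‖ₑ ≤ (C : ℝ≥0∞) *
          ((eLpNorm (AdvDiff.fn σ) ∞ (volume.restrict Ω)
              + eLpNorm (AdvDiff.field b σ) p (volume.restrict Ω))
            / ENNReal.ofReal (AdvDiff.infOn σ)) *
          ⨅ v : UH, ‖u - (v : AdvDiff.H10 Ω)‖ₑ := by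
  exact
    (AdvDiff.exists_norm_fnL_le hd hΩo hΩb).elim fun CP hCP =>
    (AdvDiff.exists_eLpNorm_fnL_smul_le hd hΩo hΩb hp).elim fun CS hCS =>
    ⟨(1 + CP ^ 2) * max 1 CS, fun b ⟨_, hbL⟩ σ hσ f UH u uH hu huH =>
      AdvDiff.enorm_sub_le_mul_iInf (u := AdvDiff.Sob.ofH10 u) (uH := AdvDiff.Sob.ofH10 uH)
        (g := fun v : UH => AdvDiff.Sob.ofH10 v.1) hΩo hΩb hbL hσ hCS
        fun _ _ hS hK v => AdvDiff.infOn_mul_norm_sub_le hΩo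
          (hbL.continuousOn.mono subset_closure) hσ hu huH hS hK hCP v.1 v.2⟩
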